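/- Conventions. Finite simple graphs are identified with the simplicial complexes of their complete subgraphs. The unit sphere $S(v)$ of a vertex $v$ of a graph is the subgraph induced on the neighbors of $v$. A graph is contractible if it is a single point, or if it has a vertex $v$ such that both $S(v)$ and the graph with $v$ removed are contractible. The empty graph is the $(-1)$-sphere; a graph is a $d$-manifold if all its unit spheres are $(d-1)$-spheres, and for $d\ge 0$ a $d$-sphere is a $d$-manifold that becomes contractible after removing some vertex. A $d$-manifold with boundary is a graph in which every unit sphere is a $(d-1)$-sphere or a $(d-1)$-ball; its boundary is the subgraph induced on the vertices whose unit sphere is not a $(d-1)$-sphere; and for $d\ge0$ a $d$-ball is a contractible $d$-manifold with boundary whose boundary is a $(d-1)$-sphere. For a finite abstract simplicial complex $G$, the unit sphere of a simplex $x\in G$ is the graph whose vertices are the simplices of $G$ that strictly contain $x$ or are strictly contained in $x$, two being connected if one is contained in the other; $G$ is a $d$-manifold if all unit spheres of its simplices are $(d-1)$-spheres. Let $d,k\ge 0$ be integers, let $G$ be a finite abstract simplicial complex that is a $d$-manifold, and let $P=K_{(n_0,\dots,n_k)}$ with all $n_j\ge 1$ be the partition complex, that is, the complex of all complete subgraphs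 of the complete $(k+1)$-partite graph with parts of sizes $n_0,\dots,n_k$. Let $f:V(G)\to V(P)$ be a map of the vertex sets that is $P$-onto, meaning that $f(V(G))$ contains the vertices of some $k$-simplex of $P$. For a facet (maximal simplex) $y$ of $P$, let the patch $f^{-1}(y)$ be the set of simplices $x\in G$ with $f(x)\supseteq y$, and let $U$ be the set of simplices $x\in G$ such that $f(x)$ contains some facet of $P$. Regard $U$ and each patch as graphs, two simplices being connected if one is contained in the other; $H(G,f,P)$ is the complex of the complete subgraphs of $U$. Then $H(G,f,P)$ is a $(d-k)$-manifold or empty; it is the union (as a complex) of the complexes of the patches $f^{-1}(y)$, where $y$ runs over the facets of $P$ with $y\subseteq f(V(G))$; and each of these patches is a $(d-k)$-manifold with boundary or empty. -/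

import Mathlib

namespace DiscreteManifold

section Graph

/-!
Finite simple graphs are handled as vertex sets `A : Set α` inside an ambient graph `Γ` on `α`:
the set `A` stands for the subgraph of `Γ` induced on `A`, which is in turn identified with its
Whitney complex, the simplicial complex of its complete subgraphs.
-/

variable {α : Type*} (Γ : SimpleGraph α)

/-- The unit sphere of `v` in `A`: the subgraph induced on the neighbors of `v` in `A`. -/
def unitSphere (A : Set α) (v : α) : Set α := A ∩ Γ.neighborSet v

/-- A graph is contractible if it is a single point, or if it has a vertex `v` such that both the
unit sphere of `v` and the graph without `v` are contractible. -/
inductive IsContractible : Set α → Prop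
  | point (v : α) : IsContractible {v}
  | step (A : Set α) (v : α) (hv : v ∈ A)
      (hS : IsContractible (unitSphere Γ A v)) (hA : IsContractible (A \ {v})) :
      IsContractible A

/-- The empty graph is the `(-1)`-sphere. For `d ≥ 0`, a `d`-sphere is a graph all of whose unit
spheres are `(d-1)`-spheres and which becomes contractible after removing some vertex. -/
inductive IsSphere : ℤ → Set α → Prop
  | empty : IsSphere (-1) ∅
  | step (d : ℤ) (A : Set α) (hd : 0 ≤ d)
      (hS : ∀ v ∈ A, IsSphere (d - 1) (unitSphere Γ A v))
      (hA : ∃ v ∈ A, IsContractible Γ (A \ {v})) :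
      IsSphere d A

/-- A `d`-manifold: all unit spheres are `(d-1)`-spheres. -/
def IsManifold (d : ℤ) (A : Set α) : Prop :=
  ∀ v ∈ A, IsSphere Γ (d - 1) (unitSphere Γ A v)

/-- The boundary points of a `d`-dimensional `A`: the vertices whose unit sphere is not a
`(d-1)`-sphere. -/
def boundary (d : ℤ) (A : Set α) : Set α :=
  {v ∈ A | ¬ IsSphere Γ (d - 1) (unitSphere Γ A v)}

/-- A `d`-ball (`d ≥ 0`): a contractible graph in which every unit sphere is a `(d-1)`-sphere or,
at the boundary points, a `(d-1)`-ball, and whose boundary is a `(d-1)`-sphere. -/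
inductive IsBall : ℤ → Set α → Prop
  | mk (d : ℤ) (A : Set α) (hd : 0 ≤ d) (hc : IsContractible Γ A)
      (hS : ∀ v ∈ boundary Γ d A, IsBall (d - 1) (unitSphere Γ A v))
      (hb : IsSphere Γ (d - 1) (boundary Γ d A)) :
      IsBall d A

/-- A `d`-manifold with boundary: every unit sphere is a `(d-1)`-sphere or a `(d-1)`-ball. -/
def IsManifoldWithBoundary (d : ℤ) (A : Set α) : Prop :=
  ∀ v ∈ A, IsSphere Γ (d - 1) (unitSphere Γ A v) ∨ IsBall Γ (d - 1) (unitSphere Γ A v)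

/-- The Whitney complex of the subgraph of `Γ` induced on `A`: its simplices are the vertex sets of
the non-empty complete subgraphs. -/
def whitneyComplex (A : Set α) : PreAbstractSimplicialComplex α where
  faces := {c | c.Nonempty ∧ (c : Set α) ⊆ A ∧ Γ.IsClique (c : Set α)}
  isRelLowerSet_faces := by
    rintro c ⟨hc, hA, hcl⟩
    refine ⟨hc, fun b hb hbn => ⟨hbn, ?_, ?_⟩⟩
    · exact (Finset.coe_subset.2 hb).trans hA
    · exact hcl.subset (Finset.coe_subset.2 hb)

end Graph

/-- The graph on finite sets in which two different sets are connected if one is contained in the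
other. -/
def inclusionGraph (V : Type*) : SimpleGraph (Finset V) :=
  SimpleGraph.fromRel fun x y => x ⊆ y

/-- The complex `G` is a `d`-manifold: for each simplex `x` of `G`, the unit sphere of `x`,
formed by the simplices of `G` strictly contained in `x` or strictly containing `x`,
is a `(d-1)`-sphere. -/
def IsManifoldComplex {V : Type*} (d : ℤ) (G : AbstractSimplicialComplex V) : Prop :=
  IsManifold (inclusionGraph V) d G.faces

/-- The partition complex of `(n 0, …, n k)`: the join of the `0`-dimensional complexes with
`n 0, …, n k` points, that is the Whitney complex of the complete multipartite graph. -/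
def partitionComplex {k : ℕ} (n : Fin (k + 1) → ℕ) :
    AbstractSimplicialComplex (Σ j, Fin (n j)) where
  toPreAbstractSimplicialComplex :=
    whitneyComplex (SimpleGraph.completeMultipartiteGraph fun j => Fin (n j)) Set.univ
  singleton_mem v := by
    refine ⟨Finset.singleton_nonempty v, Set.subset_univ _, ?_⟩
    simp

/-- The facets of a complex are its maximal simplices. -/
def IsFacet {W : Type*} (P : AbstractSimplicialComplex W) (y : Finset W) : Prop :=
  Maximal (fun z => z ∈ P.faces) y

section Pullback

variable {V W : Type*} (G : AbstractSimplicialComplex V) (f : V → W)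
  (P : AbstractSimplicialComplex W)

/-- The map `f` from the vertices of `G` to the vertices of the `k`-dimensional complex `P` is
`P`-onto: its image is `k`-dimensional, which means that it contains the vertices of a
`k`-simplex of `P`. -/
def IsOnto (k : ℕ) (f : V → W) (P : AbstractSimplicialComplex W) : Prop :=
  ∃ y ∈ P.faces, y.card = k + 1 ∧ (y : Set W) ⊆ Set.range f

/-- The set of simplices `x` of `G` such that `f(x)` contains a facet of `P`. -/
def pullbackSet : Set (Finset V) :=
  {x ∈ G.faces | ∃ y, IsFacet P y ∧ (y : Set W) ⊆ f '' (x : Set V)}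

/-- The patch `f⁻¹(y)`: the set of simplices `x` of `G` such that `f(x)` contains `y`. -/
def patchSet (y : Finset W) : Set (Finset V) :=
  {x ∈ G.faces | (y : Set W) ⊆ f '' (x : Set V)}

/-- The complex `H(G,f,P)`: the complete subgraphs of the inclusion graph on `pullbackSet G f P`. -/
def pullbackComplex : PreAbstractSimplicialComplex (Finset V) :=
  whitneyComplex (inclusionGraph V) (pullbackSet G f P)

/-- The complex of the patch `f⁻¹(y)`. -/
def patchComplex (y : Finset W) : PreAbstractSimplicialComplex (Finset V) :=
  whitneyComplex (inclusionGraph V) (patchSet G f y)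

end Pullback

end DiscreteManifold

/-!
A simplex `x` of `G` belongs to the pullback if the map to the parts of `P` paints it with all
`k + 1` colors, and to the patch of `y` if `f` maps it onto `y` or more. Both are sets of the same
kind: the simplices carrying all the colors of a given set `I`. In such a set the unit sphere of `x`
is the join of the proper faces of `x` that still carry all of `I` with the simplices of `G`
strictly containing `x`. The latter form a sphere, as an iterated unit sphere in `G`. If all colors
of `x` are in `I`, the former are the proper faces of a product of simplices, again a sphere. If
some vertex has another color, forgetting that vertex contracts them, and they form a ball whose
boundary consists of the faces carrying another color as well. The join of a sphere or a ball with a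
sphere is of the same type, and the number of complete subgraphs, which is odd for spheres and even
for contractible graphs, shows that the points of the candidate boundary are boundary points.
-/

namespace DiscreteManifold

section Graph

variable {α : Type*} {Γ : SimpleGraph α}

/-! ### Spheres are not contractible -/

/-- The vertex sets of the complete subgraphs of the graph induced on `A`. The empty set is
included, so that removing a vertex with its unit sphere splits the cliques without a correction
term. -/
def cliques (Γ : SimpleGraph α) (A : Set α) : Set (Finset α) :=
  {c | (c : Set α) ⊆ A ∧ Γ.IsClique (c : Set α)}

theorem finite_cliques {A : Set α} (hA : A.Finite) : (cliques Γ A).Finite :=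
  (Finset.finite_toSet hA.toFinset.powerset).subset fun _ hc =>
    Finset.mem_powerset.2 (hA.subset_toFinset.2 hc.1)

theorem cliques_empty : cliques Γ ∅ = {∅} := by
  ext c
  simp +contextual [cliques, Set.subset_empty_iff]

theorem unitSphere_subset_sdiff_singleton (A : Set α) (v : α) :
    unitSphere Γ A v ⊆ A \ {v} := by
  rintro u ⟨hu, huv⟩
  exact ⟨hu, fun h => Γ.irrefl (h ▸ huv)⟩

theorem unitSphere_singleton (v : α) : unitSphere Γ {v} v = ∅ :=
  Set.subset_empty_iff.1 <| (unitSphere_subset_sdiff_singleton {v} v).trans_eq (Set.sdiff_self)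

theorem notMem_of_mem_cliques_unitSphere {A : Set α} {v : α} {c : Finset α}
    (hc : c ∈ cliques Γ (unitSphere Γ A v)) : v ∉ c := fun hv =>
  (unitSphere_subset_sdiff_singleton A v (hc.1 hv)).2 rfl

theorem cliques_eq_union [DecidableEq α] {A : Set α} {v : α} (hv : v ∈ A) :
    cliques Γ A = cliques Γ (A \ {v}) ∪ insert v '' cliques Γ (unitSphere Γ A v) := by
  ext c
  constructor
  · rintro ⟨hcA, hc⟩
    by_cases hvc : v ∈ c
    · refine Or.inr ⟨c.erase v, ⟨fun u hu => ?_, hc.subset (by simp)⟩, Finset.insert_erase hvc⟩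
      obtain ⟨huv, huc⟩ := Finset.mem_erase.1 (Finset.mem_coe.1 hu)
      exact ⟨hcA huc, hc hvc huc huv.symm⟩
    · exact Or.inl ⟨Set.subset_sdiff_singleton hcA hvc, hc⟩
  · rintro (⟨hcA, hc⟩ | ⟨e, ⟨heA, he⟩, rfl⟩)
    · exact ⟨hcA.trans Set.sdiff_subset, hc⟩
    · rw [cliques, Set.mem_ofPred_eq, Finset.coe_insert]
      exact ⟨Set.insert_subset hv (heA.trans Set.inter_subset_left),
        he.insert fun u hu _ => (heA hu).2⟩

theorem ncard_cliques_eq_add {A : Set α} (hA : A.Finite) {v : α} (hv : v ∈ A) :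
    (cliques Γ A).ncard =
      (cliques Γ (A \ {v})).ncard + (cliques Γ (unitSphere Γ A v)).ncard := by
  classical
  have hinj : Set.InjOn (insert v) (cliques Γ (unitSphere Γ A v)) := fun c hc e he h => by
    rw [← Finset.erase_insert (notMem_of_mem_cliques_unitSphere hc), h,
      Finset.erase_insert (notMem_of_mem_cliques_unitSphere he)]
  have hdisj : Disjoint (cliques Γ (A \ {v})) (insert v '' cliques Γ (unitSphere Γ A v)) := by
    rw [Set.disjoint_left]
    rintro _ ⟨hc, -⟩ ⟨e, -, rfl⟩
    exact (hc (Finset.mem_insert_self v e)).2 rfl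
  rw [cliques_eq_union hv, Set.ncard_union_eq hdisj (finite_cliques hA.sdiff)
    ((finite_cliques (hA.inter_of_left _)).image _), hinj.ncard_image]

theorem IsContractible.finite {A : Set α} (h : IsContractible Γ A) : A.Finite := by
  induction h with
  | point v => exact Set.finite_singleton v
  | step _ _ _ _ _ _ ih => exact ih.of_sdiff (Set.finite_singleton _)

theorem IsSphere.finite {d : ℤ} {A : Set α} (h : IsSphere Γ d A) : A.Finite := by
  cases h with
  | empty => exact Set.finite_empty
  | step _ _ _ _ hA =>
    obtain ⟨v, -, hv⟩ := hA
    exact hv.finite.of_sdiff (Set.finite_singleton v)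

theorem IsContractible.even_ncard_cliques {A : Set α} (h : IsContractible Γ A) :
    Even (cliques Γ A).ncard := by
  induction h with
  | point v =>
    rw [ncard_cliques_eq_add (Set.finite_singleton v) (Set.mem_singleton v),
      unitSphere_singleton, Set.sdiff_self]
    exact ⟨_, rfl⟩
  | step A v hv hS hA ihS ihA =>
    rw [ncard_cliques_eq_add (IsContractible.step A v hv hS hA).finite hv]
    exact ihA.add ihS

theorem IsSphere.odd_ncard_cliques {d : ℤ} {A : Set α} (h : IsSphere Γ d A) :
    Odd (cliques Γ A).ncard := by
  induction h with
  | empty => simp [cliques_empty]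
  | step d A hd hS hA ih =>
    have hfin := (IsSphere.step d A hd hS hA).finite
    obtain ⟨v, hv, hc⟩ := hA
    rw [ncard_cliques_eq_add hfin hv]
    exact hc.even_ncard_cliques.add_odd (ih v hv)

theorem IsContractible.not_isSphere {d : ℤ} {A : Set α} (h : IsContractible Γ A) :
    ¬ IsSphere Γ d A := fun hs =>
  Nat.not_even_iff_odd.2 hs.odd_ncard_cliques h.even_ncard_cliques

/-! ### Joins -/

theorem isContractible_of_apex {A : Set α} (hA : A.Finite) {c : α} (hc : c ∈ A)
    (h : ∀ u ∈ A, u ≠ c → Γ.Adj c u) : IsContractible Γ A := by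
  induction hn : A.ncard using Nat.strong_induction_on generalizing A with
  | _ N ih =>
    by_cases! hne : ∃ u ∈ A, u ≠ c
    · obtain ⟨u, hu, huc⟩ := hne
      have hlt : (A \ {u}).ncard < N := hn ▸ Set.ncard_sdiff_singleton_lt_of_mem hu hA
      have hlt' : (unitSphere Γ A u).ncard < N :=
        (Set.ncard_le_ncard (unitSphere_subset_sdiff_singleton A u) hA.sdiff).trans_lt hlt
      exact .step A u hu
        (ih _ hlt' (hA.inter_of_left _) ⟨hc, (h u hu huc).symm⟩ (fun w hw => h w hw.1) rfl)
        (ih _ hlt hA.sdiff ⟨hc, huc.symm⟩ (fun w hw => h w hw.1) rfl)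
    · rw [Set.eq_singleton_iff_unique_mem.2 ⟨hc, hne⟩]
      exact .point c

theorem unitSphere_union_of_mem_left {A B : Set α} (h : Γ.IsCompleteBetween A B) {v : α}
    (hv : v ∈ A) : unitSphere Γ (A ∪ B) v = unitSphere Γ A v ∪ B := by
  have hB : B ⊆ Γ.neighborSet v := fun _ hb => h hv hb
  rw [unitSphere, Set.union_inter_distrib_right, Set.inter_eq_left.2 hB, unitSphere]

theorem unitSphere_union_of_mem_right {A B : Set α} (h : Γ.IsCompleteBetween A B) {v : α}
    (hv : v ∈ B) : unitSphere Γ (A ∪ B) v = A ∪ unitSphere Γ B v := by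
  rw [Set.union_comm, unitSphere_union_of_mem_left h.symm hv, Set.union_comm]

theorem union_sdiff_singleton_of_mem_left {A B : Set α} (h : Γ.IsCompleteBetween A B) {v : α}
    (hv : v ∈ A) : (A ∪ B) \ {v} = A \ {v} ∪ B := by
  rw [Set.union_sdiff_distrib, Set.sdiff_singleton_eq_self (h.disjoint.notMem_of_mem_left hv)]

theorem IsContractible.union {A B : Set α} (hA : IsContractible Γ A) (hB : B.Finite)
    (h : Γ.IsCompleteBetween A B) : IsContractible Γ (A ∪ B) := by
  induction hA with
  | point v =>
    refine isContractible_of_apex ((Set.finite_singleton v).union hB) (Or.inl rfl) ?_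
    rintro u (hu | hu) huv
    · exact absurd hu huv
    · exact h rfl hu
  | step A v hv _ _ ihS ihA =>
    refine .step _ v (Or.inl hv) ?_ ?_
    · rw [unitSphere_union_of_mem_left h hv]
      exact ihS fun a ha => h ha.1
    · rw [union_sdiff_singleton_of_mem_left h hv]
      exact ihA fun a ha => h ha.1

theorem IsSphere.isManifold {d : ℤ} {A : Set α} (h : IsSphere Γ d A) : IsManifold Γ d A := by
  cases h with
  | empty => exact fun _ hv => hv.elim
  | step _ _ _ hS _ => exact hS

theorem IsSphere.neg_one_le {d : ℤ} {A : Set α} (h : IsSphere Γ d A) : -1 ≤ d := by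
  cases h <;> omega

theorem IsSphere.union {a b : ℤ} {A B : Set α} (hA : IsSphere Γ a A) (hB : IsSphere Γ b B)
    (h : Γ.IsCompleteBetween A B) : IsSphere Γ (a + b + 1) (A ∪ B) := by
  induction hA generalizing b B with
  | empty => simpa using hB
  | step a A ha hSA hcA ihA =>
    induction hB with
    | empty => simpa using IsSphere.step a A ha hSA hcA
    | step b B hb hSB hcB ihB =>
      have hB := IsSphere.step b B hb hSB hcB
      refine .step _ _ (by omega) ?_ ?_
      · rintro v (hv | hv)
        · rw [unitSphere_union_of_mem_left h hv, show a + b + 1 - 1 = a - 1 + b + 1 by ring]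
          exact ihA v hv hB fun u hu => h hu.1
        · rw [unitSphere_union_of_mem_right h hv, show a + b + 1 - 1 = a + (b - 1) + 1 by ring]
          exact ihB v hv fun u hu w hw => h hu hw.1
      · obtain ⟨v, hv, hc⟩ := hcA
        refine ⟨v, Or.inl hv, ?_⟩
        rw [union_sdiff_singleton_of_mem_left h hv]
        exact hc.union hB.finite fun u hu => h hu.1

theorem IsBall.isContractible {d : ℤ} {A : Set α} (h : IsBall Γ d A) : IsContractible Γ A := by
  cases h
  assumption

theorem isSphere_unitSphere_of_notMem_boundary {d : ℤ} {A : Set α} {v : α} (hv : v ∈ A)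
    (hvb : v ∉ boundary Γ d A) : IsSphere Γ (d - 1) (unitSphere Γ A v) :=
  not_not.1 fun h => hvb ⟨hv, h⟩

theorem IsBall.of_boundary {d : ℤ} {A D : Set α} (hc : IsContractible Γ A) (hDA : D ⊆ A)
    (hD : IsSphere Γ (d - 1) D) (hball : ∀ v ∈ D, IsBall Γ (d - 1) (unitSphere Γ A v))
    (hsphere : ∀ v ∈ A \ D, IsSphere Γ (d - 1) (unitSphere Γ A v)) : IsBall Γ d A := by
  have hb : boundary Γ d A = D := by
    refine Set.Subset.antisymm (fun v hv => ?_) fun v hv =>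
      ⟨hDA hv, (hball v hv).isContractible.not_isSphere⟩
    by_contra hvD
    exact hv.2 (hsphere v ⟨hv.1, hvD⟩)
  have := hD.neg_one_le
  exact .mk d A (by omega) hc (hb ▸ hball) (hb ▸ hD)

theorem IsBall.union {a b : ℤ} {A B : Set α} (hA : IsBall Γ a A) (hB : IsSphere Γ b B)
    (h : Γ.IsCompleteBetween A B) : IsBall Γ (a + b + 1) (A ∪ B) := by
  induction hA generalizing b B with
  | mk a A ha hcA hSA hbA ihA =>
    induction hB with
    | empty => simpa using IsBall.mk a A ha hcA hSA hbA
    | step b B hb hSB hcB ihB =>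
      have hB := IsSphere.step b B hb hSB hcB
      have hleft : a + b + 1 - 1 = a - 1 + b + 1 := by ring
      have hright : a + b + 1 - 1 = a + (b - 1) + 1 := by ring
      refine .of_boundary (D := boundary Γ a A ∪ B) (hcA.union hB.finite h)
        (Set.union_subset_union_left _ (Set.sep_subset _ _)) ?_ ?_ ?_
      · rw [hleft]
        exact hbA.union hB fun u hu => h hu.1
      · rintro v (hv | hv)
        · rw [unitSphere_union_of_mem_left h hv.1, hleft]
          exact ihA v hv hB fun u hu => h hu.1
        · rw [unitSphere_union_of_mem_right h hv, hright]
          exact ihB v hv fun u hu w hw => h hu hw.1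
      · rintro v ⟨hv | hv, hvD⟩
        · rw [unitSphere_union_of_mem_left h hv, hleft]
          exact (isSphere_unitSphere_of_notMem_boundary hv fun hvb => hvD (Or.inl hvb)).union hB
            fun u hu => h hu.1
        · exact absurd (Or.inr hv) hvD

end Graph

section Order

/-! ### Comparability graphs -/

variable {α : Type*} [PartialOrder α] {Γ : SimpleGraph α}

/-- Two vertices of `Γ` are adjacent if and only if one is strictly smaller than the other. This is
a property of `Γ` rather than a construction, so that it passes to the dual order with `Γ`
unchanged. -/
def IsComparabilityGraph (Γ : SimpleGraph α) : Prop :=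
  ∀ u v, Γ.Adj u v ↔ u < v ∨ v < u

namespace IsComparabilityGraph

theorem dual (hΓ : IsComparabilityGraph Γ) : IsComparabilityGraph (α := αᵒᵈ) Γ := fun u v =>
  (hΓ u v).trans or_comm

theorem exists_isLeast_of_isClique (hΓ : IsComparabilityGraph Γ) {c : Finset α}
    (hc : c.Nonempty) (hcl : Γ.IsClique (c : Set α)) : ∃ z, IsLeast (c : Set α) z := by
  obtain ⟨z, hz⟩ := c.exists_minimal hc
  refine ⟨z, hz.prop, fun w hw => ?_⟩
  by_cases h : z = w
  · exact h.le
  · exact ((hΓ z w).1 (hcl hz.prop hw h)).elim le_of_lt (hz.le_of_le hw ·.le)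

/- A minimal point `w` moved by `φ` has `φ w` as an apex of its unit sphere, so the moved points
can be removed one after the other. -/
theorem isContractible_of_map_le (hΓ : IsComparabilityGraph Γ) {A : Set α} (hA : A.Finite)
    {φ : α → α} (hmaps : Set.MapsTo φ A A) (hmono : MonotoneOn φ A) (hle : ∀ u ∈ A, φ u ≤ u)
    (hidem : ∀ u ∈ A, φ (φ u) = φ u) (hfix : IsContractible Γ {u ∈ A | φ u = u}) :
    IsContractible Γ A := by
  induction hn : A.ncard using Nat.strong_induction_on generalizing A with
  | _ N ih =>
    by_cases! hall : ∀ u ∈ A, φ u = u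
    · rwa [Set.sep_eq_self_iff_mem_true.2 hall] at hfix
    obtain ⟨w, ⟨hwA, hw⟩, hmin⟩ :=
      (hA.subset (Set.sep_subset A fun u => φ u ≠ u)).exists_minimal hall
    have hlt : φ w < w := (hle w hwA).lt_of_ne hw
    refine .step A w hwA ?_ (ih _ (hn ▸ Set.ncard_sdiff_singleton_lt_of_mem hwA hA) hA.sdiff
      (fun u hu => ⟨hmaps hu.1, ?_⟩) (hmono.mono Set.sdiff_subset) (fun u hu => hle u hu.1)
      (fun u hu => hidem u hu.1) ?_ rfl)
    · refine isContractible_of_apex (hA.inter_of_left _)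
        ⟨hmaps hwA, (hΓ w (φ w)).2 (Or.inr hlt)⟩ fun u ⟨hu, hwu⟩ hne => (hΓ _ _).2 ?_
      rcases (hΓ w u).1 hwu with hwu | huw
      · exact Or.inl (hlt.trans hwu)
      · have hfixed : φ u = u := by_contra fun hu' => (hmin ⟨hu, hu'⟩ huw.le).not_gt huw
        exact Or.inr ((hfixed.symm.trans_le (hmono hu hwA huw.le)).lt_of_ne hne)
    · rintro rfl
      exact hw (hidem u hu.1)
    · convert hfix using 1
      ext u
      exact ⟨fun hu => ⟨hu.1.1, hu.2⟩, fun hu => ⟨⟨hu.1, fun h => hw (h ▸ hu.2)⟩, hu.2⟩⟩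

theorem isContractible_of_le_map (hΓ : IsComparabilityGraph Γ) {A : Set α} (hA : A.Finite)
    {φ : α → α} (hmaps : Set.MapsTo φ A A) (hmono : MonotoneOn φ A) (hle : ∀ u ∈ A, u ≤ φ u)
    (hidem : ∀ u ∈ A, φ (φ u) = φ u) (hfix : IsContractible Γ {u ∈ A | φ u = u}) :
    IsContractible Γ A :=
  hΓ.dual.isContractible_of_map_le hA hmaps hmono.dual hle hidem hfix

theorem unitSphere_eq_union (hΓ : IsComparabilityGraph Γ) (A : Set α) (z : α) :
    unitSphere Γ A z = A ∩ Set.Iio z ∪ A ∩ Set.Ioi z := by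
  rw [← Set.inter_union_distrib_left, unitSphere]
  congr 1
  ext u
  exact (hΓ z u).trans or_comm

theorem unitSphere_inter_of_covBy (hΓ : IsComparabilityGraph Γ) (A : Set α) {x y z : α}
    (hzy : z ⋖ y) (hyx : y ≤ x) :
    unitSphere Γ (A ∩ (Set.Iio y ∪ Set.Ioi x)) z = A ∩ (Set.Iio z ∪ Set.Ioi x) := by
  have hzx : z < x := hzy.lt.trans_le hyx
  rw [hΓ.unitSphere_eq_union, ← Set.inter_union_distrib_left, Set.inter_assoc]
  congr 1
  ext w
  constructor
  · rintro ⟨hwy | hxw, hwz | hzw⟩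
    · exact Or.inl hwz
    · exact absurd hwy (hzy.2 hzw)
    · exact Or.inl hwz
    · exact Or.inr hxw
  · rintro (hwz | hxw)
    · exact ⟨Or.inl (hwz.trans hzy.lt), Or.inl hwz⟩
    · exact ⟨Or.inr hxw, Or.inr (hzx.trans hxw)⟩

theorem isCompleteBetween_Iio_Ioi (hΓ : IsComparabilityGraph Γ) (A : Set α) (z : α) :
    Γ.IsCompleteBetween (A ∩ Set.Iio z) (A ∩ Set.Ioi z) := fun _ hu _ hv =>
  (hΓ _ _).2 (Or.inl (hu.2.trans hv.2))

theorem isSphere_unitSphere (hΓ : IsComparabilityGraph Γ) {a b : ℤ} {A : Set α} {z : α}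
    (hlower : IsSphere Γ a (A ∩ Set.Iio z)) (hupper : IsSphere Γ b (A ∩ Set.Ioi z)) :
    IsSphere Γ (a + b + 1) (unitSphere Γ A z) :=
  hΓ.unitSphere_eq_union A z ▸ hlower.union hupper (hΓ.isCompleteBetween_Iio_Ioi A z)

theorem isBall_unitSphere (hΓ : IsComparabilityGraph Γ) {a b : ℤ} {A : Set α} {z : α}
    (hlower : IsBall Γ a (A ∩ Set.Iio z)) (hupper : IsSphere Γ b (A ∩ Set.Ioi z)) :
    IsBall Γ (a + b + 1) (unitSphere Γ A z) :=
  hΓ.unitSphere_eq_union A z ▸ hlower.union hupper (hΓ.isCompleteBetween_Iio_Ioi A z)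

end IsComparabilityGraph

end Order

section Rainbow

/-! ### Rainbow intervals -/

variable {V ι : Type*} {g : V → ι} {I : Finset ι} {a x z : Finset V}

theorem isComparabilityGraph_inclusionGraph (V : Type*) :
    IsComparabilityGraph (inclusionGraph V) := fun x y => by
  rw [inclusionGraph, SimpleGraph.fromRel_adj, lt_iff_le_and_ne, lt_iff_le_and_ne]
  tauto

/-- The sets `w` with `a ⊆ w ⊂ x` such that every color of `I` occurs under the coloring `g` on
`w \ a`. If `I` is the set of colors of `x \ a`, these are the proper faces of a product of
simplices, with one factor for each color. -/
def rainbowInterval (g : V → ι) (I : Finset ι) (a x : Finset V) : Set (Finset V) :=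
  {w ∈ Set.Ico a x | Set.SurjOn g (w \ a : Set V) I}

theorem rainbowInterval_const (i : ι) (a x : Finset V) :
    rainbowInterval (fun _ => i) {i} a x = Set.Ioo a x := by
  ext w
  constructor
  · rintro ⟨⟨haw, hwx⟩, hw⟩
    obtain ⟨p, hp, -⟩ := hw (Finset.mem_coe.2 (Finset.mem_singleton_self i))
    exact ⟨Finset.ssubset_iff_subset_ne.2 ⟨haw, by rintro rfl; exact hp.2 hp.1⟩, hwx⟩
  · rintro ⟨haw, hwx⟩
    obtain ⟨p, hp⟩ := Finset.exists_of_ssubset haw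
    exact ⟨⟨haw.le, hwx⟩, fun j hj => ⟨p, hp, (Finset.mem_singleton.1 hj).symm⟩⟩

theorem finite_rainbowInterval (g : V → ι) (I : Finset ι) (a x : Finset V) :
    (rainbowInterval g I a x).Finite := by
  classical exact (Set.finite_Ico a x).subset (Set.sep_subset _ _)

theorem rainbowInterval_inter_Iio (hzx : z ≤ x) :
    rainbowInterval g I a x ∩ Set.Iio z = rainbowInterval g I a z := by
  ext w
  exact ⟨fun ⟨hw, hwz⟩ => ⟨⟨hw.1.1, hwz⟩, hw.2⟩,
    fun hw => ⟨⟨⟨hw.1.1, hw.1.2.trans_le hzx⟩, hw.2⟩, hw.1.2⟩⟩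

theorem rainbowInterval_inter_Ioi (hz : z ∈ rainbowInterval g I a x) :
    rainbowInterval g I a x ∩ Set.Ioi z = Set.Ioo z x := by
  ext w
  refine ⟨fun ⟨hw, hzw⟩ => ⟨hzw, hw.1.2⟩, fun ⟨hzw, hwx⟩ =>
    ⟨⟨⟨hz.1.1.trans hzw.le, hwx⟩, hz.2.mono ?_ le_rfl⟩, hzw⟩⟩
  exact Set.sdiff_subset_sdiff_left (Finset.coe_subset.2 hzw.le)

theorem card_add_card_le_of_surjOn (hax : a ⊆ x) (hI : Set.SurjOn g (x \ a : Set V) I) :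
    a.card + I.card ≤ x.card := by
  classical
  rw [← Finset.coe_sdiff] at hI
  have hle := Finset.card_le_card_of_surjOn g hI
  have hadd := Finset.card_sdiff_add_card_eq_card hax
  omega

theorem rainbowInterval_eq_empty (h : x.card ≤ a.card + I.card) :
    rainbowInterval g I a x = ∅ :=
  Set.eq_empty_of_forall_notMem fun _ hw =>
    ((card_add_card_le_of_surjOn hw.1.1 hw.2).trans_lt (Finset.card_lt_card hw.1.2)).not_ge h

theorem surjOn_sdiff_singleton {s : Set V} {p : V} (hs : Set.SurjOn g s I)
    (hp : g p ∈ I → ∃ q ∈ s, q ≠ p ∧ g q = g p) : Set.SurjOn g (s \ {p}) I := by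
  intro i hi
  obtain ⟨q, hq, rfl⟩ := hs hi
  by_cases hqp : q = p
  · subst hqp
    obtain ⟨r, hr, hrq, hgr⟩ := hp hi
    exact ⟨r, ⟨hr, hrq⟩, hgr⟩
  · exact ⟨q, ⟨hq, hqp⟩, rfl⟩

theorem surjOn_coe_erase_sdiff [DecidableEq V] {p : V} (hI : Set.SurjOn g (x \ a : Set V) I)
    (hp : g p ∈ I → ∃ q ∈ (x \ a : Set V), q ≠ p ∧ g q = g p) :
    Set.SurjOn g (x.erase p \ a : Set V) I := by
  rw [Finset.coe_erase, sdiff_right_comm]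
  exact surjOn_sdiff_singleton hI hp

/- The contraction `w ≤ w.erase p`, `w.erase p ≤ x.erase p` forgets a point `p` of a color that is
not required. -/
theorem isContractible_rainbowInterval (hax : a ⊆ x) (hI : Set.SurjOn g (x \ a : Set V) I)
    {p : V} (hp : p ∈ (x \ a : Set V)) (hpI : g p ∉ I) :
    IsContractible (inclusionGraph V) (rainbowInterval g I a x) := by
  classical
  have hmem : ∀ w, w ∈ rainbowInterval g I a x → w.erase p ∈ rainbowInterval g I a x :=
    fun w hw => ⟨⟨Finset.subset_erase.2 ⟨hw.1.1, hp.2⟩,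
      (Finset.erase_subset p w).trans_lt hw.1.2⟩,
      surjOn_coe_erase_sdiff hw.2 fun h => (hpI h).elim⟩
  have hapex : x.erase p ∈ {w ∈ rainbowInterval g I a x | w.erase p = w} :=
    ⟨⟨⟨Finset.subset_erase.2 ⟨hax, hp.2⟩, Finset.erase_ssubset hp.1⟩,
      surjOn_coe_erase_sdiff hI fun h => (hpI h).elim⟩, Finset.erase_idem⟩
  refine (isComparabilityGraph_inclusionGraph V).isContractible_of_map_le
    (φ := fun w => w.erase p) (finite_rainbowInterval g I a x) hmem
    (fun u _ v _ huv => Finset.erase_subset_erase p huv) (fun u _ => Finset.erase_subset p u)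
    (fun u _ => Finset.erase_idem) ?_
  refine isContractible_of_apex ((finite_rainbowInterval g I a x).subset (Set.sep_subset _ _))
    hapex fun u ⟨hu, hup⟩ hne => (isComparabilityGraph_inclusionGraph V _ _).2 (Or.inr ?_)
  exact lt_of_le_of_ne (hup ▸ Finset.erase_subset_erase p hu.1.2.le) hne

theorem surjOn_sdiff_singleton_sdiff_singleton_iff {s : Set V} {J : Set ι} {p : V} (hp : p ∈ s) :
    Set.SurjOn g (s \ {p}) (J \ {g p}) ↔ Set.SurjOn g s J := by
  refine ⟨fun h i hi => ?_, fun h i hi => ?_⟩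
  · by_cases hip : i = g p
    · exact ⟨p, hp, hip.symm⟩
    · exact Set.image_mono Set.sdiff_subset (h ⟨hi, hip⟩)
  · obtain ⟨q, hq, rfl⟩ := h hi.1
    exact ⟨q, ⟨hq, ne_of_apply_ne g hi.2⟩, rfl⟩

theorem surjOn_sdiff_insert_iff [DecidableEq V] [DecidableEq ι] {p : V}
    (hp : p ∈ (x \ a : Set V)) :
    Set.SurjOn g (x \ (insert p a : Finset V) : Set V) (I.erase (g p)) ↔
      Set.SurjOn g (x \ a : Set V) I := by
  rw [Finset.coe_insert, Finset.coe_erase, ← Set.union_singleton, ← Set.sdiff_sdiff,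
    surjOn_sdiff_singleton_sdiff_singleton_iff hp]

theorem sep_mem_rainbowInterval [DecidableEq V] [DecidableEq ι] {p : V} (hpa : p ∉ a) :
    {w ∈ rainbowInterval g I a x | p ∈ w} =
      rainbowInterval g (I.erase (g p)) (insert p a) x := by
  ext w
  constructor
  · rintro ⟨⟨⟨haw, hwx⟩, hw⟩, hpw⟩
    exact ⟨⟨Finset.insert_subset hpw haw, hwx⟩, (surjOn_sdiff_insert_iff ⟨hpw, hpa⟩).2 hw⟩
  · rintro ⟨⟨haw, hwx⟩, hw⟩
    obtain ⟨hpw, haw⟩ := Finset.insert_subset_iff.1 haw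
    exact ⟨⟨⟨haw, hwx⟩, (surjOn_sdiff_insert_iff ⟨hpw, hpa⟩).1 hw⟩, hpw⟩

theorem insert_mem_rainbowInterval_sdiff_singleton [DecidableEq V] {p : V} (hpx : p ∈ x)
    {w : Finset V} (hw : w ∈ rainbowInterval g I a x \ {x.erase p}) :
    insert p w ∈ rainbowInterval g I a x \ {x.erase p} := by
  obtain ⟨⟨⟨haw, hwx⟩, hwI⟩, hne⟩ := hw
  have hsub : w ⊆ insert p w := Finset.subset_insert p w
  have hins : insert p w ≠ x := by
    rintro rfl
    by_cases hpw : p ∈ w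
    · exact hwx.ne (Finset.insert_eq_self.2 hpw).symm
    · exact hne (Finset.erase_insert hpw).symm
  refine ⟨⟨⟨haw.trans hsub, (Finset.insert_subset hpx hwx.le).lt_of_ne hins⟩,
    hwI.mono (Set.sdiff_subset_sdiff_left (Finset.coe_subset.2 hsub)) le_rfl⟩, fun h => ?_⟩
  exact Finset.notMem_erase p x (h ▸ Finset.mem_insert_self p w)

/- Away from `x.erase p`, the map `insert p` deforms the interval to its members containing `p`.
For these the color of `p` is no longer required, although it still occurs at `q`. -/
theorem isContractible_rainbowInterval_sdiff_singleton [DecidableEq V] (hax : a ⊆ x)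
    (hI : Set.SurjOn g (x \ a : Set V) I) {p q : V} (hp : p ∈ (x \ a : Set V))
    (hq : q ∈ (x \ a : Set V)) (hqp : q ≠ p) (hg : g q = g p) :
    IsContractible (inclusionGraph V) (rainbowInterval g I a x \ {x.erase p}) := by
  classical
  have hfix : {w ∈ rainbowInterval g I a x \ {x.erase p} | insert p w = w} =
      rainbowInterval g (I.erase (g p)) (insert p a) x := by
    rw [← sep_mem_rainbowInterval hp.2]
    ext w
    rw [Set.mem_sep_iff, Set.mem_sep_iff, Finset.insert_eq_self]
    refine and_congr_left fun hpw => and_iff_left ?_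
    rintro rfl
    exact Finset.notMem_erase p x hpw
  refine (isComparabilityGraph_inclusionGraph V).isContractible_of_le_map
    (finite_rainbowInterval g I a x).sdiff
    (fun w hw => insert_mem_rainbowInterval_sdiff_singleton hp.1 hw)
    (fun u _ v _ huv => Finset.insert_subset_insert p huv) (fun u _ => Finset.subset_insert p u)
    (fun u _ => Finset.insert_idem p u) (hfix ▸ ?_)
  refine isContractible_rainbowInterval (Finset.insert_subset hp.1 hax)
    ((surjOn_sdiff_insert_iff hp).2 hI) ⟨hq.1, fun h => ?_⟩ (hg ▸ Finset.notMem_erase (g q) I)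
  exact (Finset.mem_insert.1 h).elim hqp hq.2

theorem exists_isContractible_rainbowInterval_sdiff_singleton (hax : a ⊆ x)
    (hI : Set.SurjOn g (x \ a : Set V) I) (hg : Set.MapsTo g (x \ a : Set V) I)
    (hcard : a.card + I.card < x.card) :
    ∃ w ∈ rainbowInterval g I a x,
      IsContractible (inclusionGraph V) (rainbowInterval g I a x \ {w}) := by
  classical
  have hlt : I.card < (x \ a).card := by
    have := Finset.card_sdiff_add_card_eq_card hax
    omega
  obtain ⟨q, hq, p, hp, hqp, hgqp⟩ :=
    Finset.exists_ne_map_eq_of_card_lt_of_maps_to hlt (by rwa [Finset.coe_sdiff])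
  rw [← Finset.mem_coe, Finset.coe_sdiff] at hq hp
  exact ⟨x.erase p,
    ⟨⟨Finset.subset_erase.2 ⟨hax, hp.2⟩, Finset.erase_ssubset hp.1⟩,
      surjOn_coe_erase_sdiff hI fun _ => ⟨q, hq, hqp, hgqp⟩⟩,
    isContractible_rainbowInterval_sdiff_singleton hax hI hp hq hqp hgqp⟩

/- Induction on `x \ a`: the unit sphere of a member `z` is the join of the rainbow interval below
`z` with `Set.Ioo z x`, which is again a rainbow interval, for a constant coloring. -/
theorem isSphere_rainbowInterval (hax : a ⊆ x) (hI : Set.SurjOn g (x \ a : Set V) I)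
    (hg : Set.MapsTo g (x \ a : Set V) I) :
    IsSphere (inclusionGraph V) (x.card - a.card - I.card - 1) (rainbowInterval g I a x) := by
  induction hm : x.card - a.card using Nat.strong_induction_on generalizing g I a x with
  | _ m ih =>
    have hle := card_add_card_le_of_surjOn hax hI
    rcases hle.eq_or_lt with heq | hlt
    · rw [rainbowInterval_eq_empty heq.ge, ← heq]
      convert IsSphere.empty using 1
      push_cast
      ring
    · refine .step _ _ (by omega) (fun z hz => ?_) ?_
      · have hxz := Finset.card_lt_card hz.1.2
        have hza := card_add_card_le_of_surjOn hz.1.1 hz.2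
        obtain ⟨p, hpx, hpz⟩ := Finset.exists_of_ssubset hz.1.2
        have hIpos : 0 < I.card := Finset.card_pos.2 ⟨g p, hg ⟨hpx, fun h => hpz (hz.1.1 h)⟩⟩
        have hlower := ih (z.card - a.card) (by omega) hz.1.1 hz.2
          (hg.mono_left (Set.sdiff_subset_sdiff_left (Finset.coe_subset.2 hz.1.2.le))) rfl
        have hupper := ih (x.card - z.card) (by omega) (g := fun _ => g p) (I := {g p}) hz.1.2.le
          (fun i hi => ⟨p, ⟨hpx, hpz⟩, (Finset.mem_singleton.1 hi).symm⟩)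
          (fun _ _ => Finset.mem_singleton_self _) rfl
        rw [rainbowInterval_const] at hupper
        rw [← rainbowInterval_inter_Iio hz.1.2.le] at hlower
        rw [← rainbowInterval_inter_Ioi hz] at hupper
        convert (isComparabilityGraph_inclusionGraph V).isSphere_unitSphere hlower hupper using 1
        rw [Finset.card_singleton]
        push_cast
        ring
      · exact exists_isContractible_rainbowInterval_sdiff_singleton hax hI hg hlt

theorem isSphere_Ioo (hzx : z ⊂ x) :
    IsSphere (inclusionGraph V) (x.card - z.card - 2) (Set.Ioo z x) := by
  obtain ⟨p, hpx, hpz⟩ := Finset.exists_of_ssubset hzx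
  rw [← rainbowInterval_const () z x]
  convert isSphere_rainbowInterval (g := fun _ => ()) (I := {()}) hzx.le (fun _ _ =>
    ⟨p, ⟨hpx, hpz⟩, rfl⟩)
    (fun _ _ => Finset.mem_singleton_self _) using 1
  rw [Finset.card_singleton]
  push_cast
  ring

open Classical in
/-- The coloring `g` with all the colors outside `I` merged into one extra color `none`. The
members of a rainbow interval that also carry the extra color form its boundary. -/
noncomputable def withExtraColor (g : V → ι) (I : Finset ι) (p : V) : Option ι :=
  if g p ∈ I then some (g p) else none

theorem withExtraColor_mem (g : V → ι) (I : Finset ι) (p : V) :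
    withExtraColor g I p ∈ Finset.insertNone I := by
  by_cases hp : g p ∈ I <;> simp [withExtraColor, hp]

theorem withExtraColor_eq_some_iff {i : ι} (hi : i ∈ I) {p : V} :
    withExtraColor g I p = some i ↔ g p = i := by
  by_cases hp : g p ∈ I
  · simp [withExtraColor, hp]
  · simp [withExtraColor, hp, ne_of_mem_of_not_mem hi hp |>.symm]

theorem withExtraColor_eq_none_iff {p : V} : withExtraColor g I p = none ↔ g p ∉ I := by
  by_cases hp : g p ∈ I <;> simp [withExtraColor, hp]

theorem surjOn_withExtraColor_iff {s : Set V} :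
    Set.SurjOn (withExtraColor g I) s (Finset.insertNone I) ↔
      Set.SurjOn g s I ∧ ∃ p ∈ s, g p ∉ I := by
  have hsome : (∀ i ∈ I, some i ∈ withExtraColor g I '' s) ↔ Set.SurjOn g s I :=
    forall₂_congr fun i hi => exists_congr fun p =>
      and_congr_right fun _ => withExtraColor_eq_some_iff hi
  have hnone : none ∈ withExtraColor g I '' s ↔ ∃ p ∈ s, g p ∉ I :=
    exists_congr fun p => and_congr_right fun _ => withExtraColor_eq_none_iff
  rw [← hsome, ← hnone, and_comm]
  exact Finset.forall_mem_insertNone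

theorem isBall_rainbowInterval (hax : a ⊆ x) (hI : Set.SurjOn g (x \ a : Set V) I)
    (hextra : ∃ p ∈ (x \ a : Set V), g p ∉ I) :
    IsBall (inclusionGraph V) (x.card - a.card - I.card - 1) (rainbowInterval g I a x) := by
  induction x using Finset.strongInduction with
  | _ x ih =>
    have hΓ := isComparabilityGraph_inclusionGraph V
    have hupper : ∀ z ∈ rainbowInterval g I a x, IsSphere (inclusionGraph V)
        (x.card - z.card - 2) (rainbowInterval g I a x ∩ Set.Ioi z) := fun z hz =>
      rainbowInterval_inter_Ioi hz ▸ isSphere_Ioo hz.1.2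
    have hdim : ∀ z : Finset V, (x.card - a.card - I.card - 1 - 1 : ℤ) =
        z.card - a.card - I.card - 1 + (x.card - z.card - 2) + 1 := fun z => by ring
    obtain ⟨p, hp, hpI⟩ := hextra
    refine .of_boundary (D := rainbowInterval (withExtraColor g I) (Finset.insertNone I) a x)
      (isContractible_rainbowInterval hax hI hp hpI)
      (fun z hz => ⟨hz.1, (surjOn_withExtraColor_iff.1 hz.2).1⟩) ?_ ?_ ?_
    · convert isSphere_rainbowInterval hax (surjOn_withExtraColor_iff.2 ⟨hI, p, hp, hpI⟩)
        (fun q _ => withExtraColor_mem g I q) using 1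
      rw [Finset.card_insertNone]
      push_cast
      ring
    · intro z hz
      obtain ⟨hzI, hzextra⟩ := surjOn_withExtraColor_iff.1 hz.2
      have hlower := ih z hz.1.2 hz.1.1 hzI hzextra
      rw [← rainbowInterval_inter_Iio hz.1.2.le] at hlower
      exact hdim z ▸ hΓ.isBall_unitSphere hlower (hupper z ⟨hz.1, hzI⟩)
    · rintro z ⟨hz, hzD⟩
      have hzg : Set.MapsTo g (z \ a : Set V) I := fun q hq => by_contra fun hqI =>
        hzD ⟨hz.1, surjOn_withExtraColor_iff.2 ⟨hz.2, q, hq, hqI⟩⟩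
      have hlower := isSphere_rainbowInterval hz.1.1 hz.2 hzg
      rw [← rainbowInterval_inter_Iio hz.1.2.le] at hlower
      exact hdim z ▸ hΓ.isSphere_unitSphere hlower (hupper z hz)

end Rainbow

section Manifold

/-! ### Level sets of colorings of a manifold -/

variable {V : Type*} {G : AbstractSimplicialComplex V} {d : ℤ}

/- Each step passes to the unit sphere of `x \ insert p s` in the sphere of the previous step,
starting with the unit sphere of `x`. -/
theorem IsManifoldComplex.isSphere_inter_Iio_sdiff_union_Ioi [DecidableEq V]
    (hG : IsManifoldComplex d G) {x : Finset V} (hx : x ∈ G.faces) {s : Finset V} (hs : s ⊂ x) :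
    IsSphere (inclusionGraph V) (d - 1 - s.card)
      (G.faces ∩ (Set.Iio (x \ s) ∪ Set.Ioi x)) := by
  have hΓ := isComparabilityGraph_inclusionGraph V
  induction s using Finset.induction with
  | empty =>
    rw [Finset.sdiff_empty, Set.inter_union_distrib_left, ← hΓ.unitSphere_eq_union]
    simpa using hG x hx
  | insert p s hps ih =>
    have hp : p ∈ x \ s :=
      Finset.mem_sdiff.2 ⟨hs.le (Finset.mem_insert_self p s), hps⟩
    have hcov : x \ insert p s ⋖ x \ s := by
      rw [Finset.sdiff_insert]
      exact Finset.erase_covBy hp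
    have hface : x \ insert p s ∈ G.faces :=
      (G.isRelLowerSet_faces hx).2 Finset.sdiff_subset (Finset.sdiff_nonempty.2 hs.not_ge)
    rw [← hΓ.unitSphere_inter_of_covBy G.faces hcov Finset.sdiff_subset,
      Finset.card_insert_of_notMem hps, Nat.cast_succ, ← sub_sub]
    exact (ih ((Finset.subset_insert p s).trans_ssubset hs)).isManifold _
      ⟨hface, Or.inl hcov.lt⟩

theorem IsManifoldComplex.isSphere_inter_Ioi (hG : IsManifoldComplex d G) {x : Finset V}
    (hx : x ∈ G.faces) : IsSphere (inclusionGraph V) (d - x.card) (G.faces ∩ Set.Ioi x) := by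
  classical
  obtain ⟨p, hp⟩ := (G.isRelLowerSet_faces hx).1
  convert hG.isSphere_inter_Iio_sdiff_union_Ioi hx (Finset.erase_ssubset hp) using 1
  · rw [← Finset.card_erase_add_one hp]
    push_cast
    ring
  · ext w
    refine and_congr_right fun hw => (or_iff_right fun hwp => ?_).symm
    rw [Finset.sdiff_erase_self hp] at hwp
    exact (G.isRelLowerSet_faces hw).1.ne_empty (Finset.ssubset_singleton_iff.1 hwp)

variable {ι : Type*} {g : V → ι} {I : Finset ι} {x : Finset V}

theorem patchSet_inter_Iio (hI : I.Nonempty) (hx : x ∈ G.faces) :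
    patchSet G g I ∩ Set.Iio x = rainbowInterval g I ∅ x := by
  ext w
  rw [rainbowInterval, Set.mem_sep_iff, Finset.coe_empty, Set.sdiff_empty]
  refine ⟨fun ⟨hw, hwx⟩ => ⟨⟨Finset.empty_subset w, hwx⟩, hw.2⟩, fun ⟨⟨_, hwx⟩, hw⟩ =>
    ⟨⟨(G.isRelLowerSet_faces hx).2 hwx.le ?_, hw⟩, hwx⟩⟩
  exact Finset.coe_nonempty.1 ((hI.to_set.mono hw).of_image)

theorem patchSet_inter_Ioi (hx : x ∈ patchSet G g I) :
    patchSet G g I ∩ Set.Ioi x = G.faces ∩ Set.Ioi x := by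
  ext w
  exact and_congr_left fun hxw => and_iff_left
    (hx.2.trans (Set.image_mono (Finset.coe_subset.2 (le_of_lt hxw))))

theorem IsManifoldComplex.isSphere_unitSphere_patchSet (hG : IsManifoldComplex d G)
    (hI : I.Nonempty) (hx : x ∈ patchSet G g I) (hg : Set.MapsTo g x I) :
    IsSphere (inclusionGraph V) (d - I.card)
      (unitSphere (inclusionGraph V) (patchSet G g I) x) := by
  have hlower := isSphere_rainbowInterval (g := g) (I := I) (Finset.empty_subset x)
    (by simpa [Set.SurjOn] using hx.2) (by simpa using hg)
  have hupper := hG.isSphere_inter_Ioi hx.1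
  rw [← patchSet_inter_Iio hI hx.1] at hlower
  rw [← patchSet_inter_Ioi hx] at hupper
  convert (isComparabilityGraph_inclusionGraph V).isSphere_unitSphere hlower hupper using 1
  rw [Finset.card_empty]
  push_cast
  ring

theorem IsManifoldComplex.isBall_unitSphere_patchSet (hG : IsManifoldComplex d G)
    (hI : I.Nonempty) (hx : x ∈ patchSet G g I) (hg : ¬ Set.MapsTo g x I) :
    IsBall (inclusionGraph V) (d - I.card)
      (unitSphere (inclusionGraph V) (patchSet G g I) x) := by
  have hlower := isBall_rainbowInterval (g := g) (I := I) (Finset.empty_subset x)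
    (by simpa [Set.SurjOn] using hx.2) (by simpa [Set.MapsTo] using hg)
  have hupper := hG.isSphere_inter_Ioi hx.1
  rw [← patchSet_inter_Iio hI hx.1] at hlower
  rw [← patchSet_inter_Ioi hx] at hupper
  convert (isComparabilityGraph_inclusionGraph V).isBall_unitSphere hlower hupper using 1
  rw [Finset.card_empty]
  push_cast
  ring

theorem IsManifoldComplex.isManifold_patchSet (hG : IsManifoldComplex d G) (hI : I.Nonempty)
    (hg : ∀ v, g v ∈ I) :
    IsManifold (inclusionGraph V) (d + 1 - I.card) (patchSet G g I) := fun x hx => by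
  rw [add_sub_right_comm, add_sub_cancel_right]
  exact hG.isSphere_unitSphere_patchSet hI hx fun v _ => hg v

theorem IsManifoldComplex.isManifoldWithBoundary_patchSet (hG : IsManifoldComplex d G)
    (hI : I.Nonempty) :
    IsManifoldWithBoundary (inclusionGraph V) (d + 1 - I.card) (patchSet G g I) := fun x hx => by
  rw [add_sub_right_comm, add_sub_cancel_right]
  by_cases hg : Set.MapsTo g x I
  · exact Or.inl (hG.isSphere_unitSphere_patchSet hI hx hg)
  · exact Or.inr (hG.isBall_unitSphere_patchSet hI hx hg)

end Manifold

section Partition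

/-! ### Partition complexes -/

variable {V : Type*} {k : ℕ} {n : Fin (k + 1) → ℕ}

theorem mem_partitionComplex {y : Finset (Σ j, Fin (n j))} :
    y ∈ (partitionComplex n).faces ↔
      y.Nonempty ∧ Set.InjOn Sigma.fst (y : Set (Σ j, Fin (n j))) := by
  have hclique : (SimpleGraph.completeMultipartiteGraph fun j => Fin (n j)).IsClique
      (y : Set (Σ j, Fin (n j))) ↔ Set.InjOn Sigma.fst (y : Set (Σ j, Fin (n j))) :=
    forall₄_congr fun _ _ _ _ => not_imp_not
  exact and_congr_right fun _ => (and_iff_right (Set.subset_univ _)).trans hclique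

theorem isFacet_partitionComplex_iff (hn : ∀ j, 0 < n j) {y : Finset (Σ j, Fin (n j))} :
    IsFacet (partitionComplex n) y ↔
      Set.BijOn Sigma.fst (y : Set (Σ j, Fin (n j))) Set.univ := by
  classical
  constructor
  · refine fun hy => ⟨Set.mapsTo_univ _ _, (mem_partitionComplex.1 hy.prop).2, fun j _ => ?_⟩
    by_contra hj
    have hmem : insert ⟨j, ⟨0, hn j⟩⟩ y ∈ (partitionComplex n).faces := by
      refine mem_partitionComplex.2 ⟨Finset.insert_nonempty _ _, ?_⟩
      rw [Finset.coe_insert]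
      exact (Set.injOn_insert fun h => hj ⟨_, h, rfl⟩).2 ⟨(mem_partitionComplex.1 hy.prop).2, hj⟩
    exact hj ⟨_, hy.le_of_ge hmem (Finset.subset_insert _ _) (Finset.mem_insert_self _ _), rfl⟩
  · rintro ⟨-, hinj, hsurj⟩
    obtain ⟨p, hp, -⟩ := hsurj (Set.mem_univ 0)
    refine ⟨mem_partitionComplex.2 ⟨⟨p, hp⟩, hinj⟩, fun z hz hyz q hq => ?_⟩
    obtain ⟨r, hr, hrq⟩ := hsurj (Set.mem_univ q.1)
    exact (mem_partitionComplex.1 hz).2 (hyz hr) hq hrq ▸ hr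

theorem card_of_isFacet_partitionComplex (hn : ∀ j, 0 < n j) {y : Finset (Σ j, Fin (n j))}
    (hy : IsFacet (partitionComplex n) y) : y.card = k + 1 := by
  have hbij := (isFacet_partitionComplex_iff hn).1 hy
  rw [← Set.ncard_coe_finset, ← hbij.injOn.ncard_image, hbij.image_eq, Set.ncard_univ,
    Nat.card_fin]

theorem exists_isFacet_partitionComplex_subset_iff (hn : ∀ j, 0 < n j)
    {s : Set (Σ j, Fin (n j))} :
    (∃ y, IsFacet (partitionComplex n) y ∧ (y : Set (Σ j, Fin (n j))) ⊆ s) ↔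
      Set.SurjOn Sigma.fst s Set.univ := by
  rw [Set.surjOn_iff_exists_bijOn_subset]
  constructor
  · rintro ⟨y, hy, hys⟩
    exact ⟨y, hys, (isFacet_partitionComplex_iff hn).1 hy⟩
  · rintro ⟨t, hts, ht⟩
    refine ⟨t.toFinite.toFinset, (isFacet_partitionComplex_iff hn).2 ?_, ?_⟩ <;>
      rwa [Set.Finite.coe_toFinset]

theorem pullbackSet_partitionComplex (G : AbstractSimplicialComplex V) (hn : ∀ j, 0 < n j)
    (f : V → Σ j, Fin (n j)) :
    pullbackSet G f (partitionComplex n) = patchSet G (fun v => (f v).1) Finset.univ := by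
  ext x
  refine and_congr_right fun _ => (exists_isFacet_partitionComplex_subset_iff hn).trans ?_
  rw [Set.SurjOn, Set.image_image, Finset.coe_univ]

end Partition

theorem pullbackComplex_faces_eq_iUnion {V W : Type*} (G : AbstractSimplicialComplex V)
    (f : V → W) (P : AbstractSimplicialComplex W) :
    (pullbackComplex G f P).faces =
      ⋃ y ∈ {y | IsFacet P y ∧ (y : Set W) ⊆ Set.range f}, (patchComplex G f y).faces := by
  ext c
  simp only [Set.mem_iUnion, exists_prop]
  constructor
  · rintro ⟨hc, hcU, hcl⟩
    obtain ⟨z, hz, hmin⟩ :=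
      (isComparabilityGraph_inclusionGraph V).exists_isLeast_of_isClique hc hcl
    obtain ⟨-, y, hy, hyz⟩ := hcU hz
    exact ⟨y, ⟨hy, hyz.trans (Set.image_subset_range f z)⟩, hc, fun w hw => ⟨(hcU hw).1,
      hyz.trans (Set.image_mono (Finset.coe_subset.2 (hmin hw)))⟩, hcl⟩
  · rintro ⟨y, ⟨hy, -⟩, hc, hcy, hcl⟩
    exact ⟨hc, fun w hw => ⟨(hcy hw).1, y, hy, (hcy hw).2⟩, hcl⟩

end DiscreteManifold

open DiscreteManifold in
theorem mainTheorem3_general {V : Type*} (G : AbstractSimplicialComplex V) {d : ℤ} {k : ℕ}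
    (hG : IsManifoldComplex d G) {n : Fin (k + 1) → ℕ} (hn : ∀ j, 0 < n j)
    (f : V → Σ j, Fin (n j)) :
    IsManifold (inclusionGraph V) (d - k) (pullbackSet G f (partitionComplex n)) ∧
    (pullbackComplex G f (partitionComplex n)).faces =
      ⋃ y ∈ {y | IsFacet (partitionComplex n) y ∧ (y : Set (Σ j, Fin (n j))) ⊆ Set.range f},
        (patchComplex G f y).faces ∧
    ∀ y, IsFacet (partitionComplex n) y →
      IsManifoldWithBoundary (inclusionGraph V) (d - k) (patchSet G f y) := by
  have hdim : d - k = d + 1 - (k + 1 : ℕ) := by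
    push_cast
    ring
  rw [hdim]
  refine ⟨?_, pullbackComplex_faces_eq_iUnion G f _, fun y hy => ?_⟩
  · have hH := hG.isManifold_patchSet Finset.univ_nonempty fun v => Finset.mem_univ (f v).1
    rwa [← pullbackSet_partitionComplex G hn f, Finset.card_fin] at hH
  · have hpatch :=
      hG.isManifoldWithBoundary_patchSet (g := f) (mem_partitionComplex.1 hy.prop).1
    rwa [card_of_isFacet_partitionComplex hn hy] at hpatch

theorem mainTheorem3 {V : Type*} [Finite V] (G : AbstractSimplicialComplex V) (d k : ℕ)
    (hG : DiscreteManifold.IsManifoldComplex (d : ℤ) G)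
    (n : Fin (k + 1) → ℕ) (hn : ∀ j, 0 < n j) (f : V → Σ j, Fin (n j))
    (hf : DiscreteManifold.IsOnto k f (DiscreteManifold.partitionComplex n)) :
    (DiscreteManifold.pullbackSet G f (DiscreteManifold.partitionComplex n) = ∅ ∨
      DiscreteManifold.IsManifold (DiscreteManifold.inclusionGraph V) ((d : ℤ) - k)
        (DiscreteManifold.pullbackSet G f (DiscreteManifold.partitionComplex n))) ∧
    (DiscreteManifold.pullbackComplex G f (DiscreteManifold.partitionComplex n)).faces =
      ⋃ y ∈ {y | DiscreteManifold.IsFacet (DiscreteManifold.partitionComplex n) y ∧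
          (y : Set (Σ j, Fin (n j))) ⊆ Set.range f},
        (DiscreteManifold.patchComplex G f y).faces ∧
    ∀ y, DiscreteManifold.IsFacet (DiscreteManifold.partitionComplex n) y →
      (y : Set (Σ j, Fin (n j))) ⊆ Set.range f →
      DiscreteManifold.patchSet G f y = ∅ ∨
        DiscreteManifold.IsManifoldWithBoundary (DiscreteManifold.inclusionGraph V)
          ((d : ℤ) - k) (DiscreteManifold.patchSet G f y) := by
  obtain ⟨hH, hunion, hpatch⟩ := mainTheorem3_general G hG hn f
  exact ⟨Or.inr hH, hunion, fun y hy _ => Or.inr (hpatch y hy)⟩
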